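/- Let $p\in(0,1)$ and $p_N\in[0,1]$. Let $S\sim\mathrm{Ber}(p)$ and $N\sim\mathrm{Ber}(p_N)$ be independent, let $X=S\oplus N$ (addition modulo 2) be the output of the binary symmetric channel, regarded as a real number in $\{0,1\}$, and for $\sigma>0$ let $X^\sigma=X+\sigma Z$, where $Z\sim\mathcal N(0,1)$ is independent of $(X,S)$. Let $\eta^\sigma(x)=\mathbb E[S\mid X^\sigma=x]$, let $\mathcal H$ be the class of functions $x\mapsto s(ax+b)$ with $a,b\in\mathbb R$, where $s(z)=1/(1+e^{-z})$, let $h^*_{\mathcal H}\in\mathcal H$ be a minimizer of $h\mapsto\mathbb E[(S-h(X^\sigma))^2]$ over $\mathcal H$, and let $\epsilon_A=\mathbb E\big[|\eta^\sigma(X^\sigma)-h^*_{\mathcal H}(X^\sigma)|^2\big]$. Put $\overline{p}=1-p$, $\overline{p_N}=1-p_N$, $q=p_N\overline p+\overline{p_N}\,p$ and $\overline q=1-q$. Then a minimizer $h^*_{\mathcal H}$ exists for every $\sigma>0$, and there are constants $C_1=C_1(p,p_N)$, $C_2=C_2(p,p_N)$ and $K=K(p,p_N)$ such that for every $\sigma>0$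 and every minimizer $h^*_{\mathcal H}$, $$\epsilon_A\le \frac{3(1-2p_N)^2}{4\sigma^2}-\frac{(1-2p_N)^2}{4(q\overline q+\sigma^2)}+\frac{(1-2p_N)^2\left(5-4p_N+4p_N^2+14q-2q^2\right)}{8\sigma^4}+\frac{2(1-2p_N)^2\left(p_N\overline{p_N}-q\overline q\right)}{4\sigma^2(q\overline q+\sigma^2)}+\frac{C_1(1-2p_N)^2}{\sigma^6}+\frac{C_2(1-2p_N)^2}{\sigma^4(q\overline q+\sigma^2)},$$ and $\epsilon_A\le K/\sigma^2$; in particular $\epsilon_A=O(1/\sigma^2)$ as $\sigma\to\infty$. -/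

import Mathlib

open MeasureTheory ProbabilityTheory

noncomputable section

/-- A bit, read as the real number `0` or `1`. -/
def bitReal (b : Bool) : ℝ := if b then 1 else 0

/-- The mechanism that adds Gaussian noise at level `σ`: `X^σ = X + σ Z`. -/
def noisyObs {Ω : Type*} (X Z : Ω → ℝ) (σ : ℝ) : Ω → ℝ := fun ω => X ω + σ * Z ω

/-- The population mean squared error `E[(S - h(Y))²]` of the predictor `h` of `S` from `Y`. -/
def meanSqError {Ω : Type*} [MeasurableSpace Ω] (μ : Measure Ω) (S Y : Ω → ℝ) (h : ℝ → ℝ) : ℝ :=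
  ∫ ω, (S ω - h (Y ω)) ^ 2 ∂μ

/-- The hypothesis class of the sigmoid `s(z) = 1 / (1 + e^{-z})` composed with affine functions
`x ↦ a x + b` on the real line. -/
def sigmoidLinearClass : Set (ℝ → ℝ) :=
  {h | ∃ a b : ℝ, h = fun x => Real.sigmoid (a * x + b)}

/-- `h` is an optimal predictor of `S` from `Y` in the class `H`: it belongs to `H` and attains the
minimum of the population mean squared error over `H`. -/
def IsOptimalIn {Ω : Type*} [MeasurableSpace Ω] (μ : Measure Ω) (S Y : Ω → ℝ)
    (H : Set (ℝ → ℝ)) (h : ℝ → ℝ) : Prop :=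
  h ∈ H ∧ IsMinOn (meanSqError μ S Y) H h

/-- The approximation error `‖η - h‖₂² = E[|η(Y) - h(Y)|²]`, where `η(Y) = E[S | Y]` is the
conditional expectation of `S` given the σ-algebra generated by `Y`. -/
def approxError {Ω : Type*} [MeasurableSpace Ω] (μ : Measure Ω) (S Y : Ω → ℝ) (h : ℝ → ℝ) : ℝ :=
  ∫ ω, ((μ[S | MeasurableSpace.comap Y inferInstance]) ω - h (Y ω)) ^ 2 ∂μ

/-- Binary symmetric channel with Gaussian noise: independent bits `S ∼ Ber(p)` and `N ∼ Ber(pN)`,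
and a standard normal `Z` that is independent of the pair consisting of the channel output
`X = S ⊕ N` and the input `S`. -/
structure IsGaussianBSC {Ω : Type*} [MeasurableSpace Ω] (μ : Measure Ω) (p pN : unitInterval)
    (S N : Ω → Bool) (Z : Ω → ℝ) : Prop where
  measurable_S : Measurable S
  measurable_N : Measurable N
  measurable_Z : Measurable Z
  law_S : HasLaw S (bernoulliMeasure true false p) μ
  law_N : HasLaw N (bernoulliMeasure true false pN) μ
  law_Z : HasLaw Z (gaussianReal 0 1) μ
  indep_S_N : IndepFun S N μ
  indep_XS_Z : IndepFun (fun ω => (xor (S ω) (N ω), S ω)) Z μ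

/-- The displayed terms of the bound, as a function of `p_N`, of `q = P(X = 1)` and of `σ`. -/
def bscMainTerms (pN q σ : ℝ) : ℝ :=
  3 * (1 - 2 * pN) ^ 2 / (4 * σ ^ 2)
    - (1 - 2 * pN) ^ 2 / (4 * (q * (1 - q) + σ ^ 2))
    + (1 - 2 * pN) ^ 2 * (5 - 4 * pN + 4 * pN ^ 2 + 14 * q - 2 * q ^ 2) / (8 * σ ^ 4)
    + 2 * (1 - 2 * pN) ^ 2 * (pN * (1 - pN) - q * (1 - q)) / (4 * σ ^ 2 * (q * (1 - q) + σ ^ 2))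

end

/-! The error bound compares the optimal predictor with the constant `p`, which is itself a sigmoid
of slope `0`. By the orthogonal decomposition `integral_sq_sub_eq_add`, optimality gives `ε_A ≤ V`,
the variance of the posterior mean `η`.

Write `η - p = f(Y)`. Orthogonality turns `V` into `E[(S - p) f(Y)] = p(1-p)(1-2p_N) D`, where `D`
is the change in the Gaussian mean of `f` under a unit shift. The chi-square bound
`sq_integral_shift_sub_le` gives `D² ≤ (e^{1/σ²} - 1) A₀` with `A₀ = E f(σZ)²`, and `p(1-p) A₀ ≤ V`.
Hence `V²` is at most a multiple of `V`; cancelling leaves `V ≤ (1-2p_N)² (e^{1/σ²} - 1)/4`. The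
displayed terms start with at least twice this leading order, and the slack absorbs the `σ⁻⁴` terms
up to a `σ⁻⁶` correction.

Existence of a minimizer is a compactness argument: if the parameters of a minimizing sequence
escape to infinity, the loss tends to that of a hard threshold, and `exists_densityLoss_lt_step`
shows that some sigmoid does strictly better. -/

open Filter Topology

/-! ### Sigmoids against hard thresholds. -/

/-- The hard threshold at zero, the pointwise limit of steep sigmoids. -/
noncomputable def stepFun (t : ℝ) : ℝ := if 0 < t then 1 else 0

lemma measurable_stepFun : Measurable stepFun :=
  Measurable.ite measurableSet_Ioi measurable_const measurable_const

lemma stepFun_mem_Icc (t : ℝ) : stepFun t ∈ Set.Icc (0 : ℝ) 1 := by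
  unfold stepFun; split_ifs <;> simp

lemma sigmoid_mem_Icc (t : ℝ) : Real.sigmoid t ∈ Set.Icc (0 : ℝ) 1 :=
  ⟨Real.sigmoid_nonneg t, Real.sigmoid_le_one t⟩

lemma integral_comp_affine (Φ : ℝ → ℝ) (a b : ℝ) :
    ∫ x, Φ (a * x + b) = |a⁻¹| * ∫ u, Φ u := by
  have h := Measure.integral_comp_mul_left (fun u => Φ (u + b)) a
  rw [h, integral_add_right_eq_self Φ b, smul_eq_mul]

lemma sigmoid_le_exp (u : ℝ) : Real.sigmoid u ≤ Real.exp u := by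
  rw [Real.sigmoid_def, inv_le_comm₀ (by positivity) (by positivity), ← Real.exp_neg]
  linarith

/-- Loss gap between the sigmoid and the hard threshold on label `1`. -/
noncomputable def lossGap (u : ℝ) : ℝ := (1 - Real.sigmoid u) ^ 2 - (1 - stepFun u) ^ 2

lemma measurable_lossGap : Measurable lossGap := by
  unfold lossGap
  exact ((measurable_const.sub continuous_sigmoid.measurable).pow_const 2).sub
    ((measurable_const.sub measurable_stepFun).pow_const 2)

lemma abs_lossGap_le (u : ℝ) : |lossGap u| ≤ 2 * Real.exp (-|u|) := by
  have h1 := sigmoid_le_exp u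
  have h2 := sigmoid_le_exp (-u)
  rw [Real.sigmoid_neg] at h2
  obtain ⟨h3, h4⟩ := sigmoid_mem_Icc u
  unfold lossGap stepFun
  split_ifs with h
  · rw [abs_of_pos h, abs_le]
    constructor <;> nlinarith [Real.exp_pos (-u)]
  · rw [abs_of_nonpos (not_lt.mp h), neg_neg, abs_le]
    constructor <;> nlinarith [Real.exp_pos u]

lemma integrable_exp_neg_abs : Integrable (fun u : ℝ => Real.exp (-|u|)) := by
  rw [← integrableOn_univ, ← Set.Iic_union_Ioi (a := (0 : ℝ)), integrableOn_union]
  refine ⟨(integrableOn_exp_Iic 0).congr_fun (fun u hu => ?_) measurableSet_Iic,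
    (integrableOn_exp_neg_Ioi 0).congr_fun (fun u hu => ?_) measurableSet_Ioi⟩
  · simp [abs_of_nonpos (Set.mem_Iic.mp hu)]
  · simp [abs_of_pos (Set.mem_Ioi.mp hu)]

lemma integrable_lossGap : Integrable lossGap :=
  (integrable_exp_neg_abs.const_mul 2).mono' measurable_lossGap.aestronglyMeasurable
    (Eventually.of_forall abs_lossGap_le)

/-- Symmetrizing under `u ↦ -u` preserves the integral and turns the gap into `-2 s(u)(1 - s(u))`
away from `0`, which is negative everywhere. -/
lemma integral_lossGap_neg : ∫ u, lossGap u < 0 := by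
  have hneg : Integrable (fun u => lossGap (-u)) := integrable_lossGap.comp_neg
  have h1 : ∫ u, lossGap (-u) = ∫ u, lossGap u := integral_neg_eq_self lossGap volume
  have h2 : ∫ u, (lossGap u + lossGap (-u)) = 2 * ∫ u, lossGap u := by
    rw [integral_add integrable_lossGap hneg, h1]; ring
  have h3 : ∫ u, (lossGap u + lossGap (-u))
      = ∫ u, -(2 * (Real.sigmoid u * (1 - Real.sigmoid u))) := by
    refine integral_congr_ae ?_
    filter_upwards [Measure.ae_ne volume (0 : ℝ)] with u hu
    simp only [lossGap, stepFun, Real.sigmoid_neg]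
    rcases lt_or_gt_of_ne hu with h | h
    · rw [if_neg (by linarith), if_pos (by linarith)]; ring
    · rw [if_pos h, if_neg (by linarith)]; ring
  have hint : Integrable (fun u => 2 * (Real.sigmoid u * (1 - Real.sigmoid u))) := by
    have : Integrable (fun u => -(lossGap u + lossGap (-u))) := (integrable_lossGap.add hneg).neg
    refine this.congr ?_
    filter_upwards [Measure.ae_ne volume (0 : ℝ)] with u hu
    simp only [lossGap, stepFun, Real.sigmoid_neg]
    rcases lt_or_gt_of_ne hu with h | h
    · rw [if_neg (by linarith), if_pos (by linarith)]; ring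
    · rw [if_pos h, if_neg (by linarith)]; ring
  have hpos : ∀ u, 0 < 2 * (Real.sigmoid u * (1 - Real.sigmoid u)) := fun u => by
    have := Real.sigmoid_pos u
    have := Real.sigmoid_lt_one u
    have : 0 < 1 - Real.sigmoid u := by linarith
    positivity
  have h4 : 0 < ∫ u, 2 * (Real.sigmoid u * (1 - Real.sigmoid u)) := by
    rw [integral_pos_iff_support_of_nonneg (fun u => (hpos u).le) hint]
    have : Function.support (fun u => 2 * (Real.sigmoid u * (1 - Real.sigmoid u))) = Set.univ :=
      Set.eq_univ_of_forall fun u => (hpos u).ne'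
    rw [this]; simp
  rw [integral_neg] at h3
  linarith

/-- Concentrating a kernel of negative total mass at a zero of an affine function yields a negative
integral against any positive bounded continuous density. -/
lemma eventually_integral_comp_affine_neg {ψ f : ℝ → ℝ} (hψ : Integrable ψ) (hψ0 : ∫ u, ψ u < 0)
    (hf : Continuous f) (hfpos : ∀ x, 0 < f x) {C : ℝ} (hfC : ∀ x, f x ≤ C) {α : ℝ} (hα : α ≠ 0)
    (β : ℝ) : ∀ᶠ k : ℝ in atTop, ∫ x, ψ (k * (α * x + β)) * f x < 0 := by
  -- This is the integral after substituting `u = k(αx + β)`, up to the positive Jacobian; in the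
  -- limit `f` is frozen at the zero `-β/α`.
  have hlim : Tendsto (fun k : ℝ => ∫ u, ψ u * f ((u / k - β) / α)) atTop
      (𝓝 (∫ u, ψ u * f ((0 - β) / α))) := by
    refine tendsto_integral_filter_of_dominated_convergence (fun u => |ψ u| * C) ?_ ?_ ?_ ?_
    · refine Eventually.of_forall fun k => hψ.aestronglyMeasurable.mul ?_
      exact (hf.comp (by fun_prop)).aestronglyMeasurable
    · refine Eventually.of_forall fun k => Eventually.of_forall fun u => ?_
      rw [norm_mul, Real.norm_eq_abs, Real.norm_eq_abs, abs_of_pos (hfpos _)]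
      exact mul_le_mul_of_nonneg_left (hfC _) (abs_nonneg _)
    · exact hψ.abs.mul_const C
    · refine Eventually.of_forall fun u => Tendsto.const_mul _ ?_
      refine (hf.tendsto _).comp ?_
      exact ((tendsto_const_nhds.div_atTop tendsto_id).sub_const β).div_const α
  rw [integral_mul_const] at hlim
  have hneg : (∫ u, ψ u) * f ((0 - β) / α) < 0 := mul_neg_of_neg_of_pos hψ0 (hfpos _)
  filter_upwards [hlim.eventually (gt_mem_nhds hneg), eventually_gt_atTop 0] with k hk hk0
  have h := integral_comp_affine (fun u => ψ u * f ((u / k - β) / α)) (k * α) (k * β)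
  have h' : ∀ x, ψ (k * α * x + k * β) * f (((k * α * x + k * β) / k - β) / α)
      = ψ (k * (α * x + β)) * f x := fun x => by
    congr 2
    · ring
    · field_simp; ring
  simp only [h'] at h
  rw [h]
  refine mul_neg_of_pos_of_neg (abs_pos.mpr (by positivity)) hk

/-! ### Existence of an optimal sigmoid. -/

/-- The squared loss of a soft classifier `h` when label `1` has density `f₁` and label `0` has
density `f₀`. -/
noncomputable def densityLoss (f₁ f₀ h : ℝ → ℝ) : ℝ :=
  ∫ x, ((1 - h x) ^ 2 * f₁ x + h x ^ 2 * f₀ x)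

section Existence

variable {f₁ f₀ : ℝ → ℝ}

lemma norm_loss_le (hp₁ : ∀ x, 0 < f₁ x) (hp₀ : ∀ x, 0 < f₀ x) {h : ℝ → ℝ} {x : ℝ}
    (hh : h x ∈ Set.Icc (0 : ℝ) 1) :
    ‖(1 - h x) ^ 2 * f₁ x + h x ^ 2 * f₀ x‖ ≤ f₁ x + f₀ x := by
  obtain ⟨h0, h1⟩ := hh
  have := hp₁ x
  have := hp₀ x
  rw [Real.norm_eq_abs, abs_of_nonneg (by positivity)]
  have e1 : (1 - h x) ^ 2 ≤ 1 := by nlinarith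
  have e2 : h x ^ 2 ≤ 1 := by nlinarith
  nlinarith

lemma integrable_loss (hi₁ : Integrable f₁) (hi₀ : Integrable f₀) (hp₁ : ∀ x, 0 < f₁ x)
    (hp₀ : ∀ x, 0 < f₀ x) {h : ℝ → ℝ} (hm : Measurable h) (hh : ∀ x, h x ∈ Set.Icc (0 : ℝ) 1) :
    Integrable (fun x => (1 - h x) ^ 2 * f₁ x + h x ^ 2 * f₀ x) := by
  refine (hi₁.add hi₀).mono' ?_ (Eventually.of_forall fun x => norm_loss_le hp₁ hp₀ (hh x))
  exact ((by fun_prop : Measurable fun x => (1 - h x) ^ 2).aestronglyMeasurable.mul hi₁.1).add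
    ((by fun_prop : Measurable fun x => h x ^ 2).aestronglyMeasurable.mul hi₀.1)

lemma tendsto_densityLoss (hi₁ : Integrable f₁) (hi₀ : Integrable f₀) (hp₁ : ∀ x, 0 < f₁ x)
    (hp₀ : ∀ x, 0 < f₀ x) {h : ℕ → ℝ → ℝ} {g : ℝ → ℝ} (hm : ∀ n, Measurable (h n))
    (hh : ∀ n x, h n x ∈ Set.Icc (0 : ℝ) 1)
    (hlim : ∀ᵐ x, Tendsto (fun n => h n x) atTop (𝓝 (g x))) :
    Tendsto (fun n => densityLoss f₁ f₀ (h n)) atTop (𝓝 (densityLoss f₁ f₀ g)) := by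
  refine tendsto_integral_of_dominated_convergence (fun x => f₁ x + f₀ x) ?_ (hi₁.add hi₀) ?_ ?_
  · exact fun n => (integrable_loss hi₁ hi₀ hp₁ hp₀ (hm n) (hh n)).1
  · exact fun n => Eventually.of_forall fun x => norm_loss_le hp₁ hp₀ (hh n x)
  · filter_upwards [hlim] with x hx
    exact (((tendsto_const_nhds.sub hx).pow 2).mul_const _).add ((hx.pow 2).mul_const _)

lemma integral_pos_of_pos {f : ℝ → ℝ} (hi : Integrable f) (hp : ∀ x, 0 < f x) :
    0 < ∫ x, f x := by
  rw [integral_pos_iff_support_of_nonneg (fun u => (hp u).le) hi,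
    Set.eq_univ_of_forall (s := Function.support f) fun u => (hp u).ne']
  simp

lemma densityLoss_const (hi₁ : Integrable f₁) (hi₀ : Integrable f₀) (c : ℝ) :
    densityLoss f₁ f₀ (fun _ => c) = (1 - c) ^ 2 * (∫ x, f₁ x) + c ^ 2 * ∫ x, f₀ x := by
  unfold densityLoss
  rw [integral_add (hi₁.const_mul _) (hi₀.const_mul _), integral_const_mul, integral_const_mul]

lemma measurable_sigmoid_affine (a b : ℝ) : Measurable fun x => Real.sigmoid (a * x + b) :=
  (continuous_sigmoid.comp (by fun_prop)).measurable

lemma measurable_step_affine (a b : ℝ) : Measurable fun x => stepFun (a * x + b) :=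
  measurable_stepFun.comp (by fun_prop)

/-- A threshold of slope `0` is the constant `0` or `1`, with loss `A` or `B`, the total masses of
the labels. The best constant `A / (A + B)` lies strictly between them and has loss `AB / (A + B)`,
below both. -/
lemma exists_densityLoss_const_lt (hi₁ : Integrable f₁) (hi₀ : Integrable f₀)
    (hp₁ : ∀ x, 0 < f₁ x) (hp₀ : ∀ x, 0 < f₀ x) (β : ℝ) :
    ∃ b : ℝ, densityLoss f₁ f₀ (fun x => Real.sigmoid (0 * x + b))
      < densityLoss f₁ f₀ (fun x => stepFun (0 * x + β)) := by
  have hA := integral_pos_of_pos hi₁ hp₁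
  have hB := integral_pos_of_pos hi₀ hp₀
  simp only [zero_mul, zero_add, densityLoss_const hi₁ hi₀]
  set A := ∫ x, f₁ x
  set B := ∫ x, f₀ x
  have hs : A / (A + B) ∈ Set.range Real.sigmoid := by
    rw [Real.range_sigmoid]
    exact ⟨by positivity, by rw [div_lt_one (by positivity)]; linarith⟩
  obtain ⟨b, hb⟩ := hs
  refine ⟨b, ?_⟩
  have e : (1 - A / (A + B)) ^ 2 * A + (A / (A + B)) ^ 2 * B = A * B / (A + B) := by
    field_simp; ring
  rw [hb, e, div_lt_iff₀ (by positivity)]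
  unfold stepFun
  split_ifs <;> nlinarith [mul_pos hA hB]

/-- Some sigmoid is strictly better than a hard threshold. -/
lemma exists_densityLoss_lt_step (hi₁ : Integrable f₁) (hi₀ : Integrable f₀)
    (hc₁ : Continuous f₁) (hc₀ : Continuous f₀) (hp₁ : ∀ x, 0 < f₁ x) (hp₀ : ∀ x, 0 < f₀ x)
    {C : ℝ} (hb₁ : ∀ x, f₁ x ≤ C) (hb₀ : ∀ x, f₀ x ≤ C) (α β : ℝ) :
    ∃ a b : ℝ, densityLoss f₁ f₀ (fun x => Real.sigmoid (a * x + b))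
      < densityLoss f₁ f₀ (fun x => stepFun (α * x + β)) := by
  rcases eq_or_ne α 0 with rfl | hα
  · exact ⟨0, exists_densityLoss_const_lt hi₁ hi₀ hp₁ hp₀ β⟩
  have hneg : Integrable (fun u => lossGap (-u)) := integrable_lossGap.comp_neg
  have h1 : ∫ u, lossGap (-u) = ∫ u, lossGap u := integral_neg_eq_self lossGap volume
  have ev₁ := eventually_integral_comp_affine_neg integrable_lossGap integral_lossGap_neg hc₁ hp₁
    hb₁ hα β
  -- Since `s(-u) = 1 - s(u)`, the gap on label `0` is the reflected kernel, so one large slope `k`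
  -- improves both labels.
  have ev₀ := eventually_integral_comp_affine_neg hneg (h1 ▸ integral_lossGap_neg) hc₀ hp₀ hb₀ hα β
  obtain ⟨k, hk₁, hk₀, hk⟩ := (ev₁.and (ev₀.and (eventually_gt_atTop 0))).exists
  refine ⟨k * α, k * β, ?_⟩
  have iS := integrable_loss hi₁ hi₀ hp₁ hp₀ (measurable_sigmoid_affine (k * α) (k * β))
    (fun x => sigmoid_mem_Icc _)
  have iH := integrable_loss hi₁ hi₀ hp₁ hp₀ (measurable_step_affine α β)
    (fun x => stepFun_mem_Icc _)
  have bdd : ∀ u, ‖lossGap u‖ ≤ 2 := fun u => by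
    refine (abs_lossGap_le u).trans ?_
    have : Real.exp (-|u|) ≤ 1 := Real.exp_le_one_iff.mpr (by simp)
    linarith
  have i₁ : Integrable fun x => lossGap (k * (α * x + β)) * f₁ x :=
    hi₁.bdd_mul (measurable_lossGap.comp (by fun_prop)).aestronglyMeasurable
      (Eventually.of_forall fun x => bdd _)
  have i₀ : Integrable fun x => lossGap (-(k * (α * x + β))) * f₀ x :=
    hi₀.bdd_mul (measurable_lossGap.comp (by fun_prop)).aestronglyMeasurable
      (Eventually.of_forall fun x => bdd _)
  rw [← sub_neg]
  unfold densityLoss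
  rw [← integral_sub iS iH]
  have : ∀ᵐ x, ((1 - Real.sigmoid (k * α * x + k * β)) ^ 2 * f₁ x
        + Real.sigmoid (k * α * x + k * β) ^ 2 * f₀ x)
        - ((1 - stepFun (α * x + β)) ^ 2 * f₁ x + stepFun (α * x + β) ^ 2 * f₀ x)
      = lossGap (k * (α * x + β)) * f₁ x + lossGap (-(k * (α * x + β))) * f₀ x := by
    filter_upwards [Measure.ae_ne volume (-β / α)] with x hx
    have hx' : α * x + β ≠ 0 := fun h => hx (by field_simp; linarith)
    rw [show k * α * x + k * β = k * (α * x + β) by ring]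
    simp only [lossGap, stepFun, Real.sigmoid_neg]
    rcases lt_or_gt_of_ne hx' with h | h
    · have h2 : k * (α * x + β) < 0 := mul_neg_of_pos_of_neg hk h
      rw [if_neg h.not_gt, if_neg h2.not_gt, if_pos (by linarith)]; ring
    · have h2 : 0 < k * (α * x + β) := mul_pos hk h
      rw [if_pos h, if_pos h2, if_neg (by linarith)]; ring
  rw [integral_congr_ae this, integral_add i₁ i₀]
  linarith

lemma tendsto_sigmoid_step {v : ℕ → ℝ × ℝ} {r : ℕ → ℝ} {w : ℝ × ℝ} (hv : Tendsto v atTop (𝓝 w))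
    (hr : Tendsto r atTop atTop) {x : ℝ} (hx : w.1 * x + w.2 ≠ 0) :
    Tendsto (fun n => Real.sigmoid (r n * ((v n).1 * x + (v n).2))) atTop
      (𝓝 (stepFun (w.1 * x + w.2))) := by
  have hl : Tendsto (fun n => (v n).1 * x + (v n).2) atTop (𝓝 (w.1 * x + w.2)) :=
    (((continuous_fst.tendsto w).comp hv).mul_const x).add ((continuous_snd.tendsto w).comp hv)
  unfold stepFun
  rcases lt_or_gt_of_ne hx with h | h
  · rw [if_neg h.not_gt]
    exact Real.tendsto_sigmoid_atBot.comp (hr.atTop_mul_neg h hl)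
  · rw [if_pos h]
    exact Real.tendsto_sigmoid_atTop.comp (hr.atTop_mul_pos h hl)

lemma ae_affine_ne_zero {w : ℝ × ℝ} (hw : w ≠ 0) : ∀ᵐ x : ℝ, w.1 * x + w.2 ≠ 0 := by
  rcases eq_or_ne w.1 0 with h | h
  · refine Eventually.of_forall fun x hx => hw (Prod.ext h ?_)
    simpa [h] using hx
  · filter_upwards [Measure.ae_ne volume (-w.2 / w.1)] with x hx hx0
    exact hx (by field_simp; linarith)

/-- The squared loss attains its minimum over the sigmoids of affine functions. -/
theorem exists_forall_densityLoss_le (hi₁ : Integrable f₁) (hi₀ : Integrable f₀)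
    (hc₁ : Continuous f₁) (hc₀ : Continuous f₀) (hp₁ : ∀ x, 0 < f₁ x) (hp₀ : ∀ x, 0 < f₀ x)
    {C : ℝ} (hb₁ : ∀ x, f₁ x ≤ C) (hb₀ : ∀ x, f₀ x ≤ C) :
    ∃ a b : ℝ, ∀ a' b' : ℝ, densityLoss f₁ f₀ (fun x => Real.sigmoid (a * x + b))
      ≤ densityLoss f₁ f₀ (fun x => Real.sigmoid (a' * x + b')) := by
  set F : ℝ × ℝ → ℝ := fun u => densityLoss f₁ f₀ (fun x => Real.sigmoid (u.1 * x + u.2)) with hF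
  have hbdd : BddBelow (Set.range F) := by
    refine ⟨0, ?_⟩
    rintro _ ⟨u, rfl⟩
    exact integral_nonneg fun x => by
      have := (hp₁ x).le
      have := (hp₀ x).le
      positivity
  obtain ⟨y, -, hy, hmem⟩ := exists_seq_tendsto_sInf (Set.range_nonempty F) hbdd
  choose u hu using hmem
  have hFu : Tendsto (fun n => F (u n)) atTop (𝓝 (sInf (Set.range F))) := by simpa only [hu] using hy
  have hle : ∀ w, sInf (Set.range F) ≤ F w := fun w => csInf_le hbdd ⟨w, rfl⟩
  -- Escaping parameters are normalized to converge in direction; otherwise a subsequence stays in a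
  -- ball and its limit is the minimizer.
  by_cases htop : Tendsto (fun n => ‖u n‖) atTop atTop
  · have hball : ∃ᶠ n in atTop, (‖u n‖⁻¹ • u n) ∈ Metric.closedBall (0 : ℝ × ℝ) 1 := by
      refine Frequently.of_forall fun n => ?_
      rw [mem_closedBall_zero_iff, norm_smul, norm_inv, norm_norm]
      exact inv_mul_le_one
    obtain ⟨w, -, φ, hφ, hw⟩ := tendsto_subseq_of_frequently_bounded Metric.isBounded_closedBall hball
    have hr : Tendsto (fun n => ‖u (φ n)‖) atTop atTop := htop.comp hφ.tendsto_atTop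
    have hne : ∀ᶠ n in atTop, ‖u (φ n)‖ ≠ 0 := (hr.eventually_gt_atTop 0).mono fun n h => h.ne'
    -- The limiting direction has norm `1`, so its affine function vanishes only on a null set and
    -- the sigmoids converge a.e. to a threshold.
    have hw0 : w ≠ 0 := by
      have h1 : Tendsto (fun n => ‖‖u (φ n)‖⁻¹ • u (φ n)‖) atTop (𝓝 ‖w‖) := hw.norm
      have h2 : Tendsto (fun n => ‖‖u (φ n)‖⁻¹ • u (φ n)‖) atTop (𝓝 1) := by
        refine tendsto_const_nhds.congr' ?_
        filter_upwards [hne] with n hn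
        rw [norm_smul, norm_inv, norm_norm, inv_mul_cancel₀ hn]
      have := tendsto_nhds_unique h1 h2
      intro h
      simp [h] at this
    have hlim : Tendsto (fun n => F (u (φ n))) atTop
        (𝓝 (densityLoss f₁ f₀ fun x => stepFun (w.1 * x + w.2))) := by
      refine tendsto_densityLoss hi₁ hi₀ hp₁ hp₀ (fun n => measurable_sigmoid_affine _ _)
        (fun n x => sigmoid_mem_Icc _) ?_
      filter_upwards [ae_affine_ne_zero hw0] with x hx
      refine (tendsto_sigmoid_step hw hr hx).congr' ?_
      filter_upwards [hne] with n hn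
      congr 1
      simp only [Function.comp, Prod.smul_fst, Prod.smul_snd, smul_eq_mul]
      field_simp
    obtain ⟨a, b, hab⟩ := exists_densityLoss_lt_step hi₁ hi₀ hc₁ hc₀ hp₁ hp₀ hb₁ hb₀ w.1 w.2
    have := tendsto_nhds_unique hlim (hFu.comp hφ.tendsto_atTop)
    exact absurd (hle (a, b)) (not_le.mpr (this ▸ hab))
  · have hfreq : ∃ R, ∃ᶠ n in atTop, u n ∈ Metric.closedBall (0 : ℝ × ℝ) R := by
      rw [tendsto_atTop] at htop
      push Not at htop
      obtain ⟨R, hR⟩ := htop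
      refine ⟨R, hR.mono fun n hn => ?_⟩
      rw [mem_closedBall_zero_iff]
      exact hn.le
    obtain ⟨R, hR⟩ := hfreq
    obtain ⟨w, -, φ, hφ, hw⟩ := tendsto_subseq_of_frequently_bounded Metric.isBounded_closedBall hR
    have hlim : Tendsto (fun n => F (u (φ n))) atTop (𝓝 (F w)) := by
      refine tendsto_densityLoss hi₁ hi₀ hp₁ hp₀ (fun n => measurable_sigmoid_affine _ _)
        (fun n x => sigmoid_mem_Icc _) (Eventually.of_forall fun x => ?_)
      have : Continuous fun w : ℝ × ℝ => Real.sigmoid (w.1 * x + w.2) :=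
        continuous_sigmoid.comp (by fun_prop)
      exact (this.tendsto w).comp hw
    have := tendsto_nhds_unique hlim (hFu.comp hφ.tendsto_atTop)
    exact ⟨w.1, w.2, fun a' b' => this.trans_le (hle (a', b'))⟩

end Existence

/-! ### Gaussian shifts and densities. -/

section Gaussian

/-- Cameron–Martin shift of a scaled standard Gaussian. -/
lemma integral_gaussian_shift (f : ℝ → ℝ) {σ : ℝ} (hσ : 0 < σ) :
    ∫ z, f (1 + σ * z) ∂(gaussianReal 0 1)
      = ∫ z, f (σ * z) * Real.exp (σ⁻¹ * z - σ⁻¹ ^ 2 / 2) ∂(gaussianReal 0 1) := by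
  rw [integral_gaussianReal_eq_integral_smul one_ne_zero,
    integral_gaussianReal_eq_integral_smul one_ne_zero,
    ← integral_add_right_eq_self (fun z => gaussianPDFReal 0 1 z •
      (f (σ * z) * Real.exp (σ⁻¹ * z - σ⁻¹ ^ 2 / 2))) σ⁻¹]
  refine integral_congr_ae (Eventually.of_forall fun z => ?_)
  have e1 : σ * (z + σ⁻¹) = 1 + σ * z := by field_simp; ring
  have e2 : gaussianPDFReal 0 1 (z + σ⁻¹) * Real.exp (σ⁻¹ * (z + σ⁻¹) - σ⁻¹ ^ 2 / 2)
      = gaussianPDFReal 0 1 z := by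
    simp only [gaussianPDFReal, mul_assoc, ← Real.exp_add]
    congr 2
    push_cast
    ring
  simp only [smul_eq_mul, e1]
  rw [← e2]
  ring

lemma integrable_exp_affine_gaussian (a b : ℝ) :
    Integrable (fun z => Real.exp (a * z + b)) (gaussianReal 0 1) := by
  simp only [Real.exp_add]
  exact (integrable_exp_mul_gaussianReal a).mul_const _

lemma integral_exp_affine_gaussian (a b : ℝ) :
    ∫ z, Real.exp (a * z + b) ∂(gaussianReal 0 1) = Real.exp (a ^ 2 / 2 + b) := by
  have h := congrFun (mgf_fun_id_gaussianReal (μ := 0) (v := 1)) a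
  simp only [mgf] at h
  simp only [Real.exp_add]
  rw [integral_mul_const, h]
  simp

/-- Chi-square bound for the effect of a unit shift under Gaussian smoothing. -/
lemma sq_integral_shift_sub_le {f : ℝ → ℝ} (hf : Measurable f) {C : ℝ} (hC : ∀ x, |f x| ≤ C)
    {σ : ℝ} (hσ : 0 < σ) :
    (∫ z, f (1 + σ * z) ∂(gaussianReal 0 1) - ∫ z, f (σ * z) ∂(gaussianReal 0 1)) ^ 2
      ≤ (Real.exp (σ⁻¹ ^ 2) - 1) * ∫ z, f (σ * z) ^ 2 ∂(gaussianReal 0 1) := by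
  set γ := gaussianReal 0 1
  -- `L` is the likelihood ratio of `N(1/σ, 1)` to `N(0, 1)`: its mean is `1` and its variance is
  -- `e^{1/σ²} - 1`.
  set L : ℝ → ℝ := fun z => Real.exp (σ⁻¹ * z + -(σ⁻¹ ^ 2 / 2)) with hL
  have hfm : Measurable fun z => f (σ * z) := hf.comp (by fun_prop)
  have hL2 : ∀ z, L z ^ 2 = Real.exp (2 * σ⁻¹ * z + -(σ⁻¹ ^ 2)) := fun z => by
    rw [hL, ← Real.exp_nat_mul]; congr 1; push_cast; ring
  have iL : Integrable L γ := integrable_exp_affine_gaussian _ _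
  have iL2 : Integrable (fun z => L z ^ 2) γ := by
    simp only [hL2]; exact integrable_exp_affine_gaussian _ _
  have vL : ∫ z, L z ∂γ = 1 := by
    rw [hL, integral_exp_affine_gaussian]; simp
  have vL2 : ∫ z, L z ^ 2 ∂γ = Real.exp (σ⁻¹ ^ 2) := by
    simp only [hL2]; rw [integral_exp_affine_gaussian]; congr 1; ring
  have ifs : Integrable (fun z => f (σ * z)) γ :=
    Integrable.of_bound hfm.aestronglyMeasurable C (Eventually.of_forall fun z => hC _)
  have if2 : Integrable (fun z => f (σ * z) ^ 2) γ := by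
    refine Integrable.of_bound (hfm.pow_const 2).aestronglyMeasurable (C ^ 2)
      (Eventually.of_forall fun z => ?_)
    rw [norm_pow]
    exact pow_le_pow_left₀ (norm_nonneg _) (hC _) 2
  have ifL : Integrable (fun z => f (σ * z) * L z) γ :=
    iL.bdd_mul hfm.aestronglyMeasurable (Eventually.of_forall fun z => hC _)
  have hD : ∫ z, f (1 + σ * z) ∂γ - ∫ z, f (σ * z) ∂γ
      = ∫ z, (f (σ * z) * L z - f (σ * z)) ∂γ := by
    rw [integral_gaussian_shift f hσ, integral_sub ifL ifs]
    simp only [hL, sub_eq_add_neg, γ]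
  have iq : Integrable (fun z => L z ^ 2 - 2 * L z) γ := iL2.sub (iL.const_mul 2)
  have hE : ∫ z, (L z ^ 2 - 2 * L z + 1) ∂γ = Real.exp (σ⁻¹ ^ 2) - 1 := by
    rw [integral_add iq (integrable_const 1),
      integral_sub iL2 (iL.const_mul 2), integral_const_mul, vL, vL2]
    simp; ring
  -- Cauchy–Schwarz for `L - 1` and `f(σz)`, through the discriminant of `t ↦ ∫ ((L - 1) t +
  -- f(σz))²`.
  have hquad : ∀ t : ℝ, 0 ≤ (Real.exp (σ⁻¹ ^ 2) - 1) * (t * t)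
      + (2 * (∫ z, f (1 + σ * z) ∂γ - ∫ z, f (σ * z) ∂γ)) * t + ∫ z, f (σ * z) ^ 2 ∂γ := fun t => by
    have : 0 ≤ ∫ z, ((L z ^ 2 - 2 * L z + 1) * (t * t) + (f (σ * z) * L z - f (σ * z)) * (2 * t)
        + f (σ * z) ^ 2) ∂γ := integral_nonneg fun z => by
      have : 0 ≤ ((L z - 1) * t + f (σ * z)) ^ 2 := sq_nonneg _
      simp only [Pi.zero_apply]
      linarith
    rw [integral_add, integral_add, integral_mul_const, integral_mul_const, hE, ← hD] at this
    · linarith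
    · exact (iq.add (integrable_const 1)).mul_const _
    · exact (ifL.sub ifs).mul_const _
    · exact ((iq.add (integrable_const 1)).mul_const _).add
        ((ifL.sub ifs).mul_const _)
    · exact if2
  have := discrim_le_zero hquad
  rw [discrim] at this
  linarith

lemma integral_comp_affine_gaussian {f : ℝ → ℝ} (hf : Measurable f) {σ : ℝ} (hσ : 0 < σ) (x : ℝ) :
    ∫ z, f (x + σ * z) ∂(gaussianReal 0 1)
      = ∫ y, f y * gaussianPDFReal x (.mk (σ ^ 2) (sq_nonneg σ)) y := by
  have hv : NNReal.mk (σ ^ 2) (sq_nonneg σ) ≠ 0 := by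
    intro h
    have := congrArg NNReal.toReal h
    simp at this
    exact hσ.ne' this
  have hlaw := gaussianReal_const_add (gaussianReal_const_mul
    (HasLaw.id (μ := gaussianReal 0 1)) σ) x
  have h := hlaw.integral_comp (f := f) hf.aestronglyMeasurable
  simp only [mul_zero, zero_add, mul_one] at h
  rw [integral_gaussianReal_eq_integral_smul hv] at h
  simp only [smul_eq_mul] at h
  refine h.trans ?_
  simp only [mul_comm]

lemma continuous_gaussianPDFReal (m : ℝ) (v : NNReal) : Continuous (gaussianPDFReal m v) := by
  unfold gaussianPDFReal
  fun_prop

lemma gaussianPDFReal_le (m : ℝ) (v : NNReal) (x : ℝ) :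
    gaussianPDFReal m v x ≤ (√(2 * Real.pi * v))⁻¹ := by
  unfold gaussianPDFReal
  refine mul_le_of_le_one_right (by positivity) (Real.exp_le_one_iff.mpr ?_)
  exact div_nonpos_of_nonpos_of_nonneg (neg_nonpos.mpr (sq_nonneg _)) (by positivity)

end Gaussian

/-! ### Conditional expectation as an orthogonal projection. -/

section CondExp

variable {Ω : Type*} {m m0 : MeasurableSpace Ω} {μ : Measure[m0] Ω} [IsProbabilityMeasure μ]

lemma integrable_of_ae_abs_le {f : Ω → ℝ} (hf : AEStronglyMeasurable f μ) {C : ℝ}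
    (h : ∀ᵐ ω ∂μ, |f ω| ≤ C) : Integrable f μ :=
  Integrable.of_bound hf C h

lemma integral_mul_eq_integral_condExp_mul (hm : m ≤ m0) {S g : Ω → ℝ} (hS : Integrable S μ)
    (hg : StronglyMeasurable[m] g) {C : ℝ} (hgC : ∀ᵐ ω ∂μ, |g ω| ≤ C) :
    ∫ ω, S ω * g ω ∂μ = ∫ ω, (μ[S | m]) ω * g ω ∂μ := by
  have hSg : Integrable (S * g) μ :=
    hS.mul_bdd (hg.mono hm).aestronglyMeasurable hgC
  have h := condExp_mul_of_stronglyMeasurable_right hg hSg hS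
  calc ∫ ω, S ω * g ω ∂μ = ∫ ω, (μ[S * g | m]) ω ∂μ := (integral_condExp hm).symm
    _ = ∫ ω, (μ[S | m]) ω * g ω ∂μ := integral_congr_ae h

lemma condExp_mem_Icc {S : Ω → ℝ} (hS : Integrable S μ)
    (h01 : ∀ ω, S ω ∈ Set.Icc (0 : ℝ) 1) (hm : m ≤ m0) :
    ∀ᵐ ω ∂μ, (μ[S | m]) ω ∈ Set.Icc (0 : ℝ) 1 := by
  have h0 : 0 ≤ᵐ[μ] μ[S | m] := condExp_nonneg (Eventually.of_forall fun ω => (h01 ω).1)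
  have h1 : μ[S | m] ≤ᵐ[μ] μ[(fun _ => (1 : ℝ)) | m] :=
    condExp_mono hS (integrable_const 1) (Eventually.of_forall fun ω => (h01 ω).2)
  rw [condExp_const hm] at h1
  filter_upwards [h0, h1] with ω a b using ⟨a, b⟩

/-- Orthogonal decomposition of the squared error at the conditional expectation. -/
lemma integral_sq_sub_eq_add (hm : m ≤ m0) {S k : Ω → ℝ} (hSm : Measurable S)
    (h01 : ∀ ω, S ω ∈ Set.Icc (0 : ℝ) 1) (hk : StronglyMeasurable[m] k)
    (hk01 : ∀ ω, k ω ∈ Set.Icc (0 : ℝ) 1) :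
    ∫ ω, (S ω - k ω) ^ 2 ∂μ
      = ∫ ω, (S ω - (μ[S | m]) ω) ^ 2 ∂μ + ∫ ω, ((μ[S | m]) ω - k ω) ^ 2 ∂μ := by
  have hS : Integrable S μ := integrable_of_ae_abs_le (C := 1) hSm.aestronglyMeasurable
    (Eventually.of_forall fun ω => abs_le.mpr ⟨by linarith [(h01 ω).1], (h01 ω).2⟩)
  set η := μ[S | m] with hη
  have hη01 := condExp_mem_Icc hS h01 hm
  have hηm : StronglyMeasurable[m] η := stronglyMeasurable_condExp
  have hηm' := (hηm.mono hm).measurable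
  have hkm' := (hk.mono hm).measurable
  have bd : ∀ᵐ ω ∂μ, |η ω - k ω| ≤ 1 := by
    filter_upwards [hη01] with ω hω
    exact abs_le.mpr ⟨by linarith [hω.1, (hk01 ω).2], by linarith [hω.2, (hk01 ω).1]⟩
  have bd' : ∀ᵐ ω ∂μ, |S ω - η ω| ≤ 1 := by
    filter_upwards [hη01] with ω hω
    exact abs_le.mpr ⟨by linarith [hω.2, (h01 ω).1], by linarith [hω.1, (h01 ω).2]⟩
  have horth := integral_mul_eq_integral_condExp_mul hm hS (hηm.sub hk) bd
  have i1 : Integrable (fun ω => S ω * (η - k) ω) μ :=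
    hS.mul_bdd ((hηm.sub hk).mono hm).aestronglyMeasurable bd
  have i2 : Integrable (fun ω => η ω * (η - k) ω) μ :=
    integrable_condExp.mul_bdd ((hηm.sub hk).mono hm).aestronglyMeasurable bd
  have i3 : Integrable (fun ω => (S ω - η ω) ^ 2) μ := by
    refine integrable_of_ae_abs_le (C := 1) ((hSm.sub hηm').pow_const 2).aestronglyMeasurable ?_
    filter_upwards [bd'] with ω hω
    rw [abs_pow]; exact pow_le_one₀ (abs_nonneg _) hω
  have i4 : Integrable (fun ω => (η ω - k ω) ^ 2) μ := by
    refine integrable_of_ae_abs_le (C := 1) ((hηm'.sub hkm').pow_const 2).aestronglyMeasurable ?_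
    filter_upwards [bd] with ω hω
    rw [abs_pow]; exact pow_le_one₀ (abs_nonneg _) hω
  have hexp : ∀ ω, (S ω - k ω) ^ 2 = ((S ω - η ω) ^ 2 + (η ω - k ω) ^ 2)
      + 2 * (S ω * (η - k) ω - η ω * (η - k) ω) := fun ω => by
    simp only [Pi.sub_apply]; ring
  have i34 : Integrable (fun ω => (S ω - η ω) ^ 2 + (η ω - k ω) ^ 2) μ := i3.add i4
  have i12 : Integrable (fun ω => 2 * (S ω * (η - k) ω - η ω * (η - k) ω)) μ :=
    (i1.sub i2).const_mul 2
  simp only [hexp]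
  rw [integral_add i34 i12, integral_add i3 i4, integral_const_mul,
    integral_sub i1 i2, horth]
  ring

end CondExp

/-! ### The Gaussian binary symmetric channel. -/

lemma bitReal_mem_Icc (b : Bool) : bitReal b ∈ Set.Icc (0 : ℝ) 1 := by
  cases b <;> simp [bitReal]

lemma mixture_pos {a : ℝ} (ha : 0 < a) {t : ℝ} (ht : t ∈ Set.Icc (0 : ℝ) 1) {u v : ℝ} (hu : 0 < u)
    (hv : 0 < v) : 0 < a * (t * u + (1 - t) * v) := by
  refine mul_pos ha ?_
  rcases ht.1.eq_or_lt with rfl | h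
  · simpa using hv
  · have := mul_pos h hu
    have := mul_nonneg (sub_nonneg.mpr ht.2) hv.le
    linarith

lemma mixture_le {a : ℝ} (ha : a ∈ Set.Icc (0 : ℝ) 1) {t : ℝ} (ht : t ∈ Set.Icc (0 : ℝ) 1)
    {u v C : ℝ} (hC : 0 ≤ C) (hu : u ≤ C) (hv : v ≤ C) : a * (t * u + (1 - t) * v) ≤ C := by
  have h : t * u + (1 - t) * v ≤ C := by
    nlinarith [mul_le_mul_of_nonneg_left hu ht.1,
      mul_le_mul_of_nonneg_left hv (sub_nonneg.mpr ht.2)]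
  nlinarith [mul_le_mul_of_nonneg_left h ha.1, mul_le_mul_of_nonneg_right ha.2 hC]

namespace IsGaussianBSC

variable {Ω : Type*} [MeasurableSpace Ω] {μ : Measure Ω}
  {p pN : unitInterval} {S N : Ω → Bool} {Z : Ω → ℝ}

lemma measurable_noisyObs (H : IsGaussianBSC μ p pN S N Z) (σ : ℝ) :
    Measurable (noisyObs (fun ω => bitReal (xor (S ω) (N ω))) Z σ) :=
  ((measurable_of_countable fun u : Bool × Bool => bitReal (xor u.1 u.2)).comp
    (H.measurable_S.prodMk H.measurable_N)).add (H.measurable_Z.const_mul σ)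

lemma measurable_bitReal_input (H : IsGaussianBSC μ p pN S N Z) :
    Measurable fun ω => bitReal (S ω) :=
  (measurable_of_countable bitReal).comp H.measurable_S

variable [IsProbabilityMeasure μ]

/-- Expectations of functions of the input bit and the noisy output as finite mixtures of Gaussian
integrals. -/
lemma integral_comp_eq (H : IsGaussianBSC μ p pN S N Z) (σ : ℝ) {G : Bool → ℝ → ℝ}
    (hG : ∀ s, Measurable (G s)) {C : ℝ} (hC : ∀ s y, |G s y| ≤ C) :
    ∫ ω, G (S ω) (noisyObs (fun ω => bitReal (xor (S ω) (N ω))) Z σ ω) ∂μ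
      = p * (pN * ∫ z, G true (0 + σ * z) ∂(gaussianReal 0 1)
          + (1 - pN) * ∫ z, G true (1 + σ * z) ∂(gaussianReal 0 1))
        + (1 - p) * (pN * ∫ z, G false (1 + σ * z) ∂(gaussianReal 0 1)
          + (1 - pN) * ∫ z, G false (0 + σ * z) ∂(gaussianReal 0 1)) := by
  set W : Ω → Bool × Bool := fun ω => (xor (S ω) (N ω), S ω) with hW
  have hSN : Measurable fun ω => (S ω, N ω) := H.measurable_S.prodMk H.measurable_N
  have hWm : Measurable W :=
    (measurable_of_countable fun u : Bool × Bool => (xor u.1 u.2, u.1)).comp hSN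
  have hWlaw : HasLaw W (μ.map W) μ := ⟨hWm.aemeasurable, rfl⟩
  have : IsProbabilityMeasure (μ.map W) := Measure.isProbabilityMeasure_map hWm.aemeasurable
  have hlaw := H.indep_XS_Z.hasLaw_prod hWlaw H.law_Z
  set k : (Bool × Bool) × ℝ → ℝ := fun u => G u.1.2 (bitReal u.1.1 + σ * u.2) with hk
  have hkm : Measurable k := measurable_from_prod_countable_right fun w =>
    (hG w.2).comp (by fun_prop)
  have hki : Integrable k ((μ.map W).prod (gaussianReal 0 1)) :=
    Integrable.of_bound hkm.aestronglyMeasurable C (Eventually.of_forall fun u => hC _ _)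
  have h1 : ∫ ω, G (S ω) (noisyObs (fun ω => bitReal (xor (S ω) (N ω))) Z σ ω) ∂μ
      = ∫ u, k u ∂((μ.map W).prod (gaussianReal 0 1)) :=
    hlaw.integral_comp hkm.aestronglyMeasurable
  have hSNlaw := H.indep_S_N.hasLaw_prod H.law_S H.law_N
  set φ : Bool × Bool → ℝ := fun w => ∫ z, k (w, z) ∂(gaussianReal 0 1) with hφ
  set ψ : Bool × Bool → ℝ := fun u => φ (xor u.1 u.2, u.1) with hψ
  have h2 : ∫ w, φ w ∂(μ.map W) = ∫ u, ψ u ∂((bernoulliMeasure true false p).prod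
      (bernoulliMeasure true false pN)) := by
    rw [integral_map hWm.aemeasurable (measurable_of_countable φ).aestronglyMeasurable]
    exact hSNlaw.integral_comp (f := ψ) (measurable_of_countable ψ).aestronglyMeasurable
  have hψi : Integrable ψ ((bernoulliMeasure true false p).prod
      (bernoulliMeasure true false pN)) := Integrable.of_finite
  rw [h1, integral_prod k hki, h2, integral_prod ψ hψi]
  simp [integral_bernoulliMeasure, hψ, hφ, hk, bitReal]

/-- Given the input bit, the observation is a mixture of `N(0, σ²)` and `N(1, σ²)`. This brings the
channel under the existence theorem for positive, bounded, continuous densities. -/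
lemma meanSqError_eq_densityLoss (H : IsGaussianBSC μ p pN S N Z) {σ : ℝ} (hσ : 0 < σ)
    {h : ℝ → ℝ} (hm : Measurable h) (h01 : ∀ x, h x ∈ Set.Icc (0 : ℝ) 1) :
    meanSqError μ (fun ω => bitReal (S ω))
        (noisyObs (fun ω => bitReal (xor (S ω) (N ω))) Z σ) h
      = densityLoss
        (fun y => p * (pN * gaussianPDFReal 0 (.mk (σ ^ 2) (sq_nonneg σ)) y
          + (1 - pN) * gaussianPDFReal 1 (.mk (σ ^ 2) (sq_nonneg σ)) y))
        (fun y => (1 - p) * (pN * gaussianPDFReal 1 (.mk (σ ^ 2) (sq_nonneg σ)) y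
          + (1 - pN) * gaussianPDFReal 0 (.mk (σ ^ 2) (sq_nonneg σ)) y)) h := by
  have hG : ∀ s : Bool, Measurable fun y => (bitReal s - h y) ^ 2 := fun s =>
    (measurable_const.sub hm).pow_const 2
  have hC : ∀ (s : Bool) (y : ℝ), |(bitReal s - h y) ^ 2| ≤ 1 := fun s y => by
    obtain ⟨a, b⟩ := bitReal_mem_Icc s
    obtain ⟨c, d⟩ := h01 y
    rw [abs_pow]
    exact pow_le_one₀ (abs_nonneg _) (abs_le.mpr ⟨by linarith, by linarith⟩)
  have hi : ∀ (s : Bool) (x : ℝ), Integrable fun y => (bitReal s - h y) ^ 2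
      * gaussianPDFReal x (.mk (σ ^ 2) (sq_nonneg σ)) y := fun s x =>
    (integrable_gaussianPDFReal _ _).bdd_mul (hG s).aestronglyMeasurable
      (Eventually.of_forall fun y => hC s y)
  unfold meanSqError densityLoss
  have key := H.integral_comp_eq σ (G := fun s y => (bitReal s - h y) ^ 2) hG hC
  rw [key, integral_comp_affine_gaussian (hG true) hσ, integral_comp_affine_gaussian (hG true) hσ,
    integral_comp_affine_gaussian (hG false) hσ, integral_comp_affine_gaussian (hG false) hσ]
  simp only [← integral_const_mul]
  rw [← integral_add ((hi _ _).const_mul _) ((hi _ _).const_mul _),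
    ← integral_add ((hi _ _).const_mul _) ((hi _ _).const_mul _)]
  simp only [← integral_const_mul]
  rw [← integral_add]
  · refine integral_congr_ae (Eventually.of_forall fun y => ?_)
    simp only [bitReal, if_true, Bool.false_eq_true, if_false]
    ring
  · exact (((hi _ _).const_mul _).add ((hi _ _).const_mul _)).const_mul _
  · exact (((hi _ _).const_mul _).add ((hi _ _).const_mul _)).const_mul _

theorem exists_isOptimalIn (H : IsGaussianBSC μ p pN S N Z) (hp0 : 0 < p) (hp1 : p < 1) {σ : ℝ}
    (hσ : 0 < σ) :
    ∃ h, IsOptimalIn μ (fun ω => bitReal (S ω))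
      (noisyObs (fun ω => bitReal (xor (S ω) (N ω))) Z σ) sigmoidLinearClass h := by
  have hv : NNReal.mk (σ ^ 2) (sq_nonneg σ) ≠ 0 := by
    intro h
    have := congrArg NNReal.toReal h
    simp at this
    exact hσ.ne' this
  have hp0' : (0 : ℝ) < p := hp0
  have hp1' : (0 : ℝ) < 1 - p := sub_pos.mpr hp1
  have ht : (pN : ℝ) ∈ Set.Icc (0 : ℝ) 1 := pN.2
  set v := NNReal.mk (σ ^ 2) (sq_nonneg σ)
  have hC : 0 ≤ (√(2 * Real.pi * v))⁻¹ := by positivity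
  have hi := fun x : ℝ => integrable_gaussianPDFReal x v
  have hc := fun x : ℝ => continuous_gaussianPDFReal x v
  obtain ⟨a, b, hab⟩ := exists_forall_densityLoss_le
    (f₁ := fun y => p * (pN * gaussianPDFReal 0 v y + (1 - pN) * gaussianPDFReal 1 v y))
    (f₀ := fun y => (1 - p) * (pN * gaussianPDFReal 1 v y + (1 - pN) * gaussianPDFReal 0 v y))
    ((((hi 0).const_mul _).add ((hi 1).const_mul _)).const_mul _)
    ((((hi 1).const_mul _).add ((hi 0).const_mul _)).const_mul _)
    ((((hc 0).const_mul _).add ((hc 1).const_mul _)).const_mul _)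
    ((((hc 1).const_mul _).add ((hc 0).const_mul _)).const_mul _)
    (fun y => mixture_pos hp0' ht (gaussianPDFReal_pos _ _ _ hv) (gaussianPDFReal_pos _ _ _ hv))
    (fun y => mixture_pos hp1' ht (gaussianPDFReal_pos _ _ _ hv) (gaussianPDFReal_pos _ _ _ hv))
    (fun y => mixture_le p.2 ht hC (gaussianPDFReal_le _ _ _) (gaussianPDFReal_le _ _ _))
    (fun y => mixture_le ⟨hp1'.le, by linarith⟩ ht hC (gaussianPDFReal_le _ _ _)
      (gaussianPDFReal_le _ _ _))
  refine ⟨fun x => Real.sigmoid (a * x + b), ⟨a, b, rfl⟩, ?_⟩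
  rintro _ ⟨a', b', rfl⟩
  change meanSqError _ _ _ _ ≤ meanSqError _ _ _ _
  rw [H.meanSqError_eq_densityLoss hσ (measurable_sigmoid_affine _ _) fun x => sigmoid_mem_Icc _,
    H.meanSqError_eq_densityLoss hσ (measurable_sigmoid_affine _ _) fun x => sigmoid_mem_Icc _]
  exact hab a' b'

/-- The variance of the posterior mean of the input bit is at most `(1 - 2 p_N)² (e^{1/σ²} - 1) / 4`,
and at most `1`. -/
theorem integral_sq_condExp_sub_le (H : IsGaussianBSC μ p pN S N Z) (hp0 : 0 < p) (hp1 : p < 1)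
    {σ : ℝ} (hσ : 0 < σ) :
    ∫ ω, ((μ[fun ω => bitReal (S ω) | MeasurableSpace.comap
        (noisyObs (fun ω => bitReal (xor (S ω) (N ω))) Z σ) inferInstance]) ω - p) ^ 2 ∂μ
      ≤ min ((1 - 2 * (pN : ℝ)) ^ 2 * (Real.exp (σ⁻¹ ^ 2) - 1) / 4) 1 := by
  set Y := noisyObs (fun ω => bitReal (xor (S ω) (N ω))) Z σ with hY
  have hm : MeasurableSpace.comap Y inferInstance ≤ ‹MeasurableSpace Ω› :=
    (H.measurable_noisyObs σ).comap_le
  set S' : Ω → ℝ := fun ω => bitReal (S ω) with hS'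
  set η := μ[S' | MeasurableSpace.comap Y inferInstance] with hη
  have h01 : ∀ ω, S' ω ∈ Set.Icc (0 : ℝ) 1 := fun ω => bitReal_mem_Icc _
  have hS : Integrable S' μ := integrable_of_ae_abs_le (C := 1)
    H.measurable_bitReal_input.aestronglyMeasurable
    (Eventually.of_forall fun ω => abs_le.mpr ⟨by linarith [(h01 ω).1], (h01 ω).2⟩)
  have hη01 : ∀ᵐ ω ∂μ, η ω ∈ Set.Icc (0 : ℝ) 1 := condExp_mem_Icc hS h01 hm
  have hp0' : (0 : ℝ) < p := hp0
  have hp1' : (0 : ℝ) < 1 - p := sub_pos.mpr hp1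
  have hηm : StronglyMeasurable[MeasurableSpace.comap Y inferInstance] η :=
    stronglyMeasurable_condExp
  obtain ⟨g, hgm, hg⟩ := hηm.exists_eq_measurable_comp
  -- The factorization `η = g(Y)` controls `g` only along `Y`. Truncation makes `f` bounded
  -- everywhere, as the Gaussian formulas require, and changes nothing a.e. because `η - p` lies in
  -- `[-1, 1]`.
  set f : ℝ → ℝ := fun y => max (-1) (min 1 (g y - p)) with hf
  have hfm : Measurable f :=
    measurable_const.max (measurable_const.min (hgm.measurable.sub_const _))
  have hfC : ∀ y, |f y| ≤ 1 := fun y =>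
    abs_le.mpr ⟨le_max_left _ _, max_le (by norm_num) (min_le_left _ _)⟩
  have hfη : ∀ᵐ ω ∂μ, f (Y ω) = η ω - p := by
    filter_upwards [hη01] with ω hω
    have e : g (Y ω) = η ω := (congrFun hg ω).symm
    simp only [hf, e]
    rw [min_eq_right (by linarith [hω.2]), max_eq_right (by linarith [hω.1])]
  set A₀ := ∫ z, f (σ * z) ^ 2 ∂(gaussianReal 0 1)
  set A₁ := ∫ z, f (1 + σ * z) ^ 2 ∂(gaussianReal 0 1)
  set D := ∫ z, f (1 + σ * z) ∂(gaussianReal 0 1) - ∫ z, f (σ * z) ∂(gaussianReal 0 1) with hD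
  set V := ∫ ω, (η ω - p) ^ 2 ∂μ with hV
  have hVA : V = p * (pN * A₀ + (1 - pN) * A₁) + (1 - p) * (pN * A₁ + (1 - pN) * A₀) := by
    have h1 : V = ∫ ω, f (Y ω) ^ 2 ∂μ := integral_congr_ae <| by
      filter_upwards [hfη] with ω hω
      rw [hω]
    rw [h1]
    have h2 := H.integral_comp_eq σ (G := fun _ y => f y ^ 2) (C := 1)
      (fun _ => hfm.pow_const 2)
      (fun _ y => by rw [abs_pow]; exact pow_le_one₀ (abs_nonneg _) (hfC y))
    rw [h2]
    simp only [zero_add, A₀, A₁]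
  -- Orthogonality replaces one factor `η - p` by `S - p`; the two label values then enter with
  -- weights `±p(1-p)`, leaving only a difference of shifted means.
  have hVD : V = p * (1 - p) * (1 - 2 * pN) * D := by
    set d : Ω → ℝ := fun ω => η ω - p with hd
    have hdm : StronglyMeasurable[MeasurableSpace.comap Y inferInstance] d :=
      hηm.sub stronglyMeasurable_const
    have hbd : ∀ᵐ ω ∂μ, ‖d ω‖ ≤ 1 := by
      filter_upwards [hη01] with ω hω
      exact abs_le.mpr ⟨by linarith [hω.1], by linarith [hω.2]⟩
    have horth := integral_mul_eq_integral_condExp_mul hm hS hdm hbd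
    have hsm : AEStronglyMeasurable d μ := (hdm.mono hm).aestronglyMeasurable
    have iS : Integrable (fun ω => S' ω * d ω) μ := hS.mul_bdd hsm hbd
    have iη : Integrable (fun ω => η ω * d ω) μ := integrable_condExp.mul_bdd hsm hbd
    have ic : Integrable (fun ω => (p : ℝ) * d ω) μ :=
      (integrable_of_ae_abs_le hsm hbd).const_mul _
    have h1 : V = ∫ ω, (S' ω - p) * f (Y ω) ∂μ := by
      calc V = ∫ ω, (η ω * d ω - p * d ω) ∂μ := by
            refine integral_congr_ae (Eventually.of_forall fun ω => ?_)
            simp only [hd]; ring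
        _ = ∫ ω, (S' ω * d ω - p * d ω) ∂μ := by
            rw [integral_sub iη ic, integral_sub iS ic, horth]
        _ = ∫ ω, (S' ω - p) * f (Y ω) ∂μ := by
            refine integral_congr_ae ?_
            filter_upwards [hfη] with ω hω
            rw [hω]
            ring
    have h2 := H.integral_comp_eq σ (G := fun s y => (bitReal s - p) * f y) (C := 1)
      (fun s => hfm.const_mul _) (fun s y => by
        rw [abs_mul]
        refine mul_le_one₀ (abs_le.mpr ?_) (abs_nonneg _) (hfC y)
        obtain ⟨a, b⟩ := bitReal_mem_Icc s
        constructor <;> linarith)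
    rw [h1, h2, hD]
    simp only [integral_const_mul, zero_add, bitReal, if_true, Bool.false_eq_true, if_false]
    ring
  have hshift : D ^ 2 ≤ (Real.exp (σ⁻¹ ^ 2) - 1) * A₀ := sq_integral_shift_sub_le hfm hfC hσ
  have hA₀ : 0 ≤ A₀ := integral_nonneg fun z => sq_nonneg _
  have hA₁ : 0 ≤ A₁ := integral_nonneg fun z => sq_nonneg _
  have hV0 : 0 ≤ V := integral_nonneg fun ω => sq_nonneg _
  have hE : 0 ≤ Real.exp (σ⁻¹ ^ 2) - 1 := sub_nonneg.mpr (Real.one_le_exp (by positivity))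
  obtain ⟨hn0, hn1⟩ : (pN : ℝ) ∈ Set.Icc (0 : ℝ) 1 := pN.2
  have hn1' : (0 : ℝ) ≤ 1 - pN := sub_nonneg.mpr hn1
  refine le_min ?_ ?_
  · set c : ℝ := p * (1 - p) with hc
    have hcpos : 0 < c := mul_pos hp0' hp1'
    have hc4 : c ≤ 1 / 4 := by nlinarith [sq_nonneg ((p : ℝ) - 1 / 2)]
    -- The weight of `A₀` in `V` is `P(X = 0) = p p_N + (1-p)(1-p_N)`, which is at least `p(1-p)`.
    have hVA₀ : c * A₀ ≤ V := by
      have e : V - c * A₀ = (p ^ 2 * pN + (1 - p) ^ 2 * (1 - pN)) * A₀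
          + (p * (1 - pN) + (1 - p) * pN) * A₁ := by rw [hVA, hc]; ring
      have : 0 ≤ V - c * A₀ := by rw [e]; positivity
      linarith
    set κ := (1 - 2 * (pN : ℝ)) ^ 2 with hκ
    set E := Real.exp (σ⁻¹ ^ 2) - 1
    have hκ0 : 0 ≤ κ := sq_nonneg _
    have hVV : V * V ≤ (c * κ * E) * V := by
      calc V * V = c ^ 2 * κ * D ^ 2 := by rw [hVD, hκ]; ring
        _ ≤ c ^ 2 * κ * (E * A₀) := mul_le_mul_of_nonneg_left hshift (by positivity)
        _ = (c * κ * E) * (c * A₀) := by ring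
        _ ≤ (c * κ * E) * V := mul_le_mul_of_nonneg_left hVA₀ (by positivity)
    have hle : V ≤ c * κ * E := by
      rcases hV0.eq_or_lt with h | h
      · rw [← h]; positivity
      · exact le_of_mul_le_mul_right hVV h
    calc V ≤ c * (κ * E) := by linarith
      _ ≤ 1 / 4 * (κ * E) := mul_le_mul_of_nonneg_right hc4 (by positivity)
      _ = κ * E / 4 := by ring
  · calc V ≤ ∫ _, (1 : ℝ) ∂μ := by
          refine integral_mono_of_nonneg (Eventually.of_forall fun ω => sq_nonneg _)
            (integrable_const 1) ?_
          filter_upwards [hη01] with ω hω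
          nlinarith [hω.1, hω.2]
      _ = 1 := by simp

/-- Because `0 < p < 1`, the constant `p` is a competitor in the class. The irreducible error is
common to both predictors and cancels. -/
theorem approxError_le (H : IsGaussianBSC μ p pN S N Z) (hp0 : 0 < p) (hp1 : p < 1)
    {σ : ℝ} (hσ : 0 < σ) {h : ℝ → ℝ} (hopt : IsOptimalIn μ (fun ω => bitReal (S ω))
      (noisyObs (fun ω => bitReal (xor (S ω) (N ω))) Z σ) sigmoidLinearClass h) :
    approxError μ (fun ω => bitReal (S ω)) (noisyObs (fun ω => bitReal (xor (S ω) (N ω))) Z σ) h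
      ≤ min ((1 - 2 * (pN : ℝ)) ^ 2 * (Real.exp (σ⁻¹ ^ 2) - 1) / 4) 1 := by
  refine le_trans ?_ (H.integral_sq_condExp_sub_le hp0 hp1 hσ)
  obtain ⟨⟨a, b, rfl⟩, hmin⟩ := hopt
  set Y := noisyObs (fun ω => bitReal (xor (S ω) (N ω))) Z σ
  have hm : MeasurableSpace.comap Y inferInstance ≤ ‹MeasurableSpace Ω› :=
    (H.measurable_noisyObs σ).comap_le
  obtain ⟨t, ht⟩ : (p : ℝ) ∈ Set.range Real.sigmoid := by
    rw [Real.range_sigmoid]; exact ⟨hp0, hp1⟩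
  have hle : meanSqError μ (fun ω => bitReal (S ω)) Y (fun x => Real.sigmoid (a * x + b))
      ≤ meanSqError μ (fun ω => bitReal (S ω)) Y (fun x => Real.sigmoid (0 * x + t)) :=
    hmin ⟨0, t, rfl⟩
  have hY : Measurable[MeasurableSpace.comap Y inferInstance] Y := comap_measurable Y
  have e₁ := integral_sq_sub_eq_add (μ := μ) hm H.measurable_bitReal_input
    (fun ω => bitReal_mem_Icc _) (k := fun ω => Real.sigmoid (a * Y ω + b))
    ((measurable_sigmoid_affine a b).comp hY).stronglyMeasurable (fun ω => sigmoid_mem_Icc _)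
  have e₂ := integral_sq_sub_eq_add (μ := μ) hm H.measurable_bitReal_input
    (fun ω => bitReal_mem_Icc _) (k := fun ω => (p : ℝ)) stronglyMeasurable_const (fun ω => p.2)
  simp only [meanSqError, zero_mul, zero_add, ht] at hle
  rw [e₁, e₂] at hle
  unfold approxError
  linarith

end IsGaussianBSC

/-! ### Comparison with the displayed bound. -/

/-- A variance bound of order `1/σ²` with leading constant `1/4` is dominated by the main terms and a
cubic correction in `1/σ²`. -/
lemma quarter_bound_le_bscMainTerms {n q C σ : ℝ} (hn : n ∈ Set.Icc (0 : ℝ) 1)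
    (hq : q ∈ Set.Icc (0 : ℝ) 1) (hσ : 0 < σ) :
    (1 - 2 * n) ^ 2 * (1 / (4 * σ ^ 2) + C / σ ^ 4)
      ≤ bscMainTerms n q σ + (C + 1 / 8) ^ 2 * (1 - 2 * n) ^ 2 / σ ^ 6 := by
  have hs : 0 < σ ^ 2 := by positivity
  have hqq : 0 ≤ q * (1 - q) := mul_nonneg hq.1 (sub_nonneg.mpr hq.2)
  have hnn : 0 ≤ n * (1 - n) := mul_nonneg hn.1 (sub_nonneg.mpr hn.2)
  have hqq4 : q * (1 - q) ≤ 1 / 4 := by nlinarith [sq_nonneg (q - 1 / 2)]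
  set t := 1 / σ ^ 2 with ht
  have ht0 : 0 < t := by positivity
  set r := 1 / (q * (1 - q) + σ ^ 2) with hr
  have hr0 : 0 < r := by positivity
  have hrt : r ≤ t := one_div_le_one_div_of_le hs (by linarith)
  set κ := (1 - 2 * n) ^ 2 with hκ
  have hκ0 : 0 ≤ κ := sq_nonneg _
  have hP : 0 ≤ 5 - 4 * n + 4 * n ^ 2 + 14 * q - 2 * q ^ 2 := by
    linarith [sq_nonneg (1 - 2 * n), hq.1]
  have e₁ : κ * (1 / (4 * σ ^ 2) + C / σ ^ 4) = κ * (t / 4 + C * t ^ 2) := by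
    rw [ht]; field_simp
  have e₂ : bscMainTerms n q σ + (C + 1 / 8) ^ 2 * κ / σ ^ 6
      = κ * (3 / 4 * t - r / 4 + (5 - 4 * n + 4 * n ^ 2 + 14 * q - 2 * q ^ 2) / 8 * t ^ 2
        + (n * (1 - n) - q * (1 - q)) / 2 * (t * r) + (C + 1 / 8) ^ 2 * t ^ 3) := by
    rw [ht, hr, bscMainTerms, ← hκ]
    field_simp
    ring
  rw [e₁, e₂]
  refine mul_le_mul_of_nonneg_left ?_ hκ0
  have h₁ : 0 ≤ (5 - 4 * n + 4 * n ^ 2 + 14 * q - 2 * q ^ 2) / 8 * t ^ 2 := by positivity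
  have h₂ : -(1 / 8 * t ^ 2) ≤ (n * (1 - n) - q * (1 - q)) / 2 * (t * r) := by
    have a : t * r ≤ t ^ 2 := by
      rw [sq]; exact mul_le_mul_of_nonneg_left hrt ht0.le
    have b : 0 ≤ t * r := by positivity
    linarith [mul_nonneg hnn b, mul_nonneg (sub_nonneg.mpr hqq4) b]
  -- Since `r ≤ t`, the terms `3t/4 - r/4` exceed the needed `t/4` by at least `t/4`. Completing a
  -- square trades this slack and a cubic term for the `t²` terms, the extra `1/8` coming from `h₂`.
  have h₃ : (C + 1 / 8) * t ^ 2 ≤ t / 4 + (C + 1 / 8) ^ 2 * t ^ 3 := by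
    have := mul_nonneg ht0.le (sq_nonneg (1 / 2 - (C + 1 / 8) * t))
    linarith
  linarith

lemma exp_sub_one_le {t : ℝ} (h0 : 0 ≤ t) (h1 : t ≤ 1) : Real.exp t - 1 ≤ t + t ^ 2 := by
  have := Real.abs_exp_sub_one_sub_id_le (x := t) (by rwa [abs_of_nonneg h0])
  linarith [(abs_le.mp this).2]

/-- A quantity bounded by both `κ (e^t - 1) / 4` and `1` is bounded by `κ` times a quadratic. -/
lemma le_quadratic_of_le_min {κ t x : ℝ} (hκ : 0 ≤ κ) (ht : 0 ≤ t)
    (hx : x ≤ min (κ * (Real.exp t - 1) / 4) 1) :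
    x ≤ κ * (t / 4 + (1 / 4 + 1 / κ) * t ^ 2) := by
  obtain ⟨h1, h2⟩ := le_min_iff.mp hx
  -- At `κ = 0` the first bound already forces `x ≤ 0`. For `κ > 0`, the coefficient `1/κ`
  -- contributes exactly `t²`, which dominates the bound `1` once `t ≥ 1`.
  rcases hκ.eq_or_lt with rfl | hκ
  · simpa using h1
  have e : κ * (t / 4 + (1 / 4 + 1 / κ) * t ^ 2) = κ * (t + t ^ 2) / 4 + t ^ 2 := by
    field_simp; ring
  rw [e]
  rcases le_total t 1 with h | h
  · have := mul_le_mul_of_nonneg_left (exp_sub_one_le ht h) hκ.le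
    nlinarith
  · have : 0 ≤ κ * (t + t ^ 2) := by positivity
    nlinarith

theorem theorem3 (p pN : unitInterval) (hp0 : 0 < p) (hp1 : p < 1) (q : ℝ)
    (hq : q = (pN : ℝ) * (1 - p) + (1 - pN) * p) :
    ∃ C₁ C₂ K : ℝ, ∀ {Ω : Type*} [MeasurableSpace Ω] (μ : Measure Ω) [IsProbabilityMeasure μ]
      (S N : Ω → Bool) (Z : Ω → ℝ), IsGaussianBSC μ p pN S N Z → ∀ σ : ℝ, 0 < σ →
      let S' : Ω → ℝ := fun ω => bitReal (S ω)
      let Xσ : Ω → ℝ := noisyObs (fun ω => bitReal (xor (S ω) (N ω))) Z σ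
      (∃ h, IsOptimalIn μ S' Xσ sigmoidLinearClass h) ∧
      ∀ h, IsOptimalIn μ S' Xσ sigmoidLinearClass h →
        approxError μ S' Xσ h ≤ bscMainTerms pN q σ
            + C₁ * (1 - 2 * (pN : ℝ)) ^ 2 / σ ^ 6
            + C₂ * (1 - 2 * (pN : ℝ)) ^ 2 / (σ ^ 4 * (q * (1 - q) + σ ^ 2)) ∧
        approxError μ S' Xσ h ≤ K / σ ^ 2 := by
  set κ := (1 - 2 * (pN : ℝ)) ^ 2 with hκ
  have hκ0 : 0 ≤ κ := sq_nonneg _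
  -- No `C₂` term is needed. In `K`, the first summand serves `σ ≥ 1`, where `σ⁻⁴ ≤ σ⁻²`; the added
  -- `1` serves `σ ≤ 1`, where the error is at most `1 ≤ σ⁻²`.
  refine ⟨(1 / 4 + 1 / κ + 1 / 8) ^ 2, 0, κ * (1 / 4 + (1 / 4 + 1 / κ)) + 1, ?_⟩
  intro Ω _ μ _ S N Z H σ hσ S' Xσ
  refine ⟨H.exists_isOptimalIn hp0 hp1 hσ, fun h hopt => ?_⟩
  have hmin := H.approxError_le hp0 hp1 hσ hopt
  have hquad := le_quadratic_of_le_min hκ0 (by positivity) hmin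
  have hone := (le_min_iff.mp hmin).2
  have hn : (pN : ℝ) ∈ Set.Icc (0 : ℝ) 1 := pN.2
  have hp : (p : ℝ) ∈ Set.Icc (0 : ℝ) 1 := p.2
  have hq01 : q ∈ Set.Icc (0 : ℝ) 1 := by
    have a := mul_nonneg hn.1 (sub_nonneg.mpr hp.2)
    have b := mul_nonneg (sub_nonneg.mpr hn.2) hp.1
    have c := mul_nonneg hn.1 hp.1
    have d := mul_nonneg (sub_nonneg.mpr hn.2) (sub_nonneg.mpr hp.2)
    constructor <;> nlinarith
  constructor
  · have := quarter_bound_le_bscMainTerms (C := 1 / 4 + 1 / κ) hn hq01 hσ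
    rw [← hκ] at this
    have e : κ * (σ⁻¹ ^ 2 / 4 + (1 / 4 + 1 / κ) * (σ⁻¹ ^ 2) ^ 2)
        = κ * (1 / (4 * σ ^ 2) + (1 / 4 + 1 / κ) / σ ^ 4) := by
      congr 1
      rw [inv_pow, div_eq_mul_inv _ (σ ^ 4)]
      congr 1
      · field_simp
      · rw [inv_pow]; ring
    rw [zero_mul, zero_div, add_zero]
    linarith
  · have hM : 0 ≤ κ * (1 / 4 + (1 / 4 + 1 / κ)) := by positivity
    rw [div_eq_mul_inv, ← inv_pow]
    set t := σ⁻¹ ^ 2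
    have ht : 0 ≤ t := by positivity
    rcases le_total t 1 with h1 | h1
    · have hB : 0 ≤ κ * (1 / 4 + 1 / κ) := by positivity
      have : κ * (1 / 4 + 1 / κ) * t ^ 2 ≤ κ * (1 / 4 + 1 / κ) * t :=
        mul_le_mul_of_nonneg_left (by nlinarith) hB
      linarith
    · nlinarith
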